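/- Let $(M,\nabla)$ be a compact connected affine manifold of dimension $n$ (that is, a compact, connected, Hausdorff smooth manifold without boundary with an atlas of affine coordinate charts, whose transition functions are locally of the form $x\mapsto Ax+b$; equivalently, a manifold with a flat torsion-free connection $\nabla$, and then $\nabla du=\left(\frac{\partial^2u}{\partial x^i\partial x^j}\right)$ in affine coordinates). Let $g_0$ be a smooth Hessian metric on $M$, i.e. a smooth Riemannian metric that near every point is of the form $\nabla d\psi$ for a smooth function $\psi$, and let $f\in C^\infty(M)$. Then there is a constant $C>0$, depending only on $(M,\nabla)$, $g_0$ and $f$, such that every $\varphi\in C^\infty([0,\infty)\times M)$ satisfying $$\frac{\partial\varphi}{\partial t}=\log\frac{\det(g_0+\nabla d\varphi)}{\det g_0}+f,\qquad g_0+\nabla d\varphi>0,\qquad \varphi|_{t=0}=0$$ on $[0,\infty)\times M$ satisfies $$\|\tilde\varphi(t,\cdot)\|_{C^0(M)}\le C\qquad\text{for all } t\in[0,\infty),$$ where $$\tilde\varphi:=\varphi-\frac{1}{\mathrm{Vol}_{g_0}(M)}\int_M\varphi\,dV_{g_0},\qquad \mathrm{Vol}_{g_0}(M):=\int_M dV_{g_0}.$$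 -/

import Mathlib

open scoped Manifold ContDiff Topology

noncomputable section

namespace HessianFlow

/-- `ℝⁿ`, the space in which the charts take their values. -/
abbrev Model (n : ℕ) : Type := EuclideanSpace ℝ (Fin n)

/-- The atlas of `M` is an affine atlas: every transition function is, near each point of its
domain, the restriction of an affine map `x ↦ A x + b` of `ℝⁿ`.  Its charts are the affine
coordinate systems; the flat torsion-free connection `∇` is the one whose Christoffel symbols
vanish in each of these charts. -/
def IsAffineAtlas (n : ℕ) (M : Type*) [TopologicalSpace M] [ChartedSpace (Model n) M] : Prop :=
  ∀ e ∈ atlas (Model n) M, ∀ e' ∈ atlas (Model n) M, ∀ x ∈ (e.symm ≫ₕ e').source,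
    ∃ (A : Model n →L[ℝ] Model n) (b : Model n),
      ∀ᶠ y in 𝓝 x, (e.symm ≫ₕ e') y = A y + b

variable {n : ℕ} {M : Type*} [TopologicalSpace M] [ChartedSpace (Model n) M]

/-- The components `∂²u/∂xⁱ∂xʲ` of `∇du` in the affine chart `e`, at the point of `M` with
coordinates `y`. -/
def hessMatrix (e : OpenPartialHomeomorph M (Model n)) (u : M → ℝ) (y : Model n) :
    Matrix (Fin n) (Fin n) ℝ :=
  Matrix.of fun i j =>
    iteratedFDeriv ℝ 2 (u ∘ e.symm) y
      ![EuclideanSpace.single i (1 : ℝ), EuclideanSpace.single j (1 : ℝ)]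

variable [IsManifold (𝓡 n) ∞ M]

variable (n M) in
/-- Smooth Riemannian metrics on `M`. -/
abbrev SmoothMetric : Type _ :=
  Bundle.ContMDiffRiemannianMetric (𝓡 n) ∞ (Model n) (TangentSpace (𝓡 n) : M → Type)

/-- The components `g_{ij} = g(∂/∂xⁱ, ∂/∂xʲ)` of the metric `g` in the chart `e`, at the point
of `M` with coordinates `y`. -/
def metricMatrix (g : SmoothMetric n M) (e : OpenPartialHomeomorph M (Model n)) (y : Model n) :
    Matrix (Fin n) (Fin n) ℝ :=
  Matrix.of fun i j =>
    g.inner (e.symm y)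
      (mfderiv (𝓡 n) (𝓡 n) e.symm y (EuclideanSpace.single i (1 : ℝ) : Model n))
      (mfderiv (𝓡 n) (𝓡 n) e.symm y (EuclideanSpace.single j (1 : ℝ) : Model n))

/-- `g` is a Hessian metric: near every point it is `∇dψ` for a smooth function `ψ`. -/
def IsHessianMetric (g : SmoothMetric n M) : Prop :=
  ∀ p : M, ∃ U : Set M, IsOpen U ∧ p ∈ U ∧
    ∃ ψ : M → ℝ, ContMDiffOn (𝓡 n) 𝓘(ℝ, ℝ) ∞ ψ U ∧
      ∀ e ∈ atlas (Model n) M, ∀ y ∈ e.target, e.symm y ∈ U →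
        metricMatrix g e y = hessMatrix e ψ y

section Volume

variable [MeasurableSpace M]

/-- The measure `√(det g_{ij}) dx¹ ⋯ dxⁿ` of the domain of the chart `e`, seen on `M`. -/
def chartVolume (g : SmoothMetric n M) (e : OpenPartialHomeomorph M (Model n)) :
    MeasureTheory.Measure M :=
  (((MeasureTheory.volume : MeasureTheory.Measure (Model n)).restrict e.target).withDensity
    fun y => ENNReal.ofReal (Real.sqrt (metricMatrix g e y).det)).map e.symm

/-- The Riemannian volume measure `dV_g`: the least measure that dominates the measures
`√(det g_{ij}) dx` of all the charts.  These agree on overlaps, so that `dV_g` restricts to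
`√(det g_{ij}) dx` on the domain of each chart. -/
def riemannianVolume (g : SmoothMetric n M) : MeasureTheory.Measure M :=
  ⨆ e ∈ atlas (Model n) M, chartVolume g e

/-- The normalization `u - (1 / Vol_g(M)) ∫_M u dV_g`. -/
def normalization (g : SmoothMetric n M) (u : M → ℝ) (x : M) : ℝ :=
  u x - (1 / (riemannianVolume g Set.univ).toReal) * ∫ y, u y ∂(riemannianVolume g)

end Volume

/-- `φ` is a smooth solution on `[0, ∞) × M` of
`∂φ/∂t = log (det (g₀ + ∇dφ) / det g₀) + f`, `g₀ + ∇dφ > 0`, `φ|_{t = 0} = 0`.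
At `t = 0` the time derivative is the right derivative. -/
structure IsFlowSolution (g₀ : SmoothMetric n M) (f : M → ℝ) (φ : ℝ → M → ℝ) : Prop where
  smooth : ContMDiffOn (𝓘(ℝ, ℝ).prod (𝓡 n)) 𝓘(ℝ, ℝ) ∞ (fun p : ℝ × M => φ p.1 p.2)
    (Set.Ici 0 ×ˢ Set.univ)
  initial : ∀ x, φ 0 x = 0
  posDef : ∀ t, 0 ≤ t → ∀ e ∈ atlas (Model n) M, ∀ y ∈ e.target,
    (metricMatrix g₀ e y + hessMatrix e (φ t) y).PosDef
  equation : ∀ t, 0 ≤ t → ∀ e ∈ atlas (Model n) M, ∀ y ∈ e.target,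
    HasDerivWithinAt (fun s => φ s (e.symm y))
      (Real.log ((metricMatrix g₀ e y + hessMatrix e (φ t) y).det / (metricMatrix g₀ e y).det)
        + f (e.symm y))
      (Set.Ici 0) t

end HessianFlow

end

namespace HessianFlow

open MeasureTheory

/-! The estimate is made at each fixed time, from `g₀ + ∇dφ > 0`. In a chart this says that the
Hessian of `u = φ t` is at least `-g₀`, hence locally at least `-K`: `u` is semiconvex with
constants independent of `u`. If `u ≤ S`, midpoint convexity at `q`, with `S` bounding `u` at the
reflection of `x` through `q`, gives the local Harnack inequality `S - u x ≤ 2 * (S - u q) + B`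
(`exists_nhds_forall_sub_le`). Compactness and connectedness make it global
(`exists_forall_le_mul_add_of_local`). Taking `S = max u` and `q` a maximum point removes the
multiplicative term and bounds the oscillation (`exists_forall_sub_le_of_isAdmissible`). Subtracting
the mean keeps this bound once the volume is known to be finite and nonzero; finiteness rests on the
agreement of the chart measures on overlaps. -/

/-! ### Semiconvexity along segments, and quadratic forms of matrices -/

/-- A function whose second derivative in the direction `w` is at least `-c` along the segment
`[q - w, q + w]` is, up to `c / 2`, midpoint convex there. -/
theorem le_midpoint_add_of_neg_le_iteratedFDeriv_two {E : Type*} [NormedAddCommGroup E]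
    [NormedSpace ℝ E] {F : E → ℝ} {s : Set E} (hs : IsOpen s) (hF : ContDiffOn ℝ 2 F s)
    {q w : E} {c : ℝ} (hseg : ∀ t ∈ Set.Icc (-1 : ℝ) 1, q + t • w ∈ s)
    (hc : ∀ t ∈ Set.Icc (-1 : ℝ) 1, -c ≤ iteratedFDeriv ℝ 2 F (q + t • w) ![w, w]) :
    F q ≤ (F (q + w) + F (q - w)) / 2 + c / 2 := by
  have hline : ∀ t : ℝ, HasDerivAt (fun t : ℝ => q + t • w) w t := fun t => by
    simpa using ((hasDerivAt_id t).smul_const w).const_add q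
  have hd1 : ∀ t ∈ Set.Icc (-1 : ℝ) 1,
      HasDerivAt (fun t : ℝ => F (q + t • w) + c / 2 * t ^ 2)
        (fderiv ℝ F (q + t • w) w + c * t) t := fun t ht => by
    have h1 : DifferentiableAt ℝ F (q + t • w) :=
      (hF.differentiableOn (by norm_num)).differentiableAt (hs.mem_nhds (hseg t ht))
    have h2 : HasDerivAt (fun t : ℝ => F (q + t • w)) (fderiv ℝ F (q + t • w) w) t :=
      h1.hasFDerivAt.comp_hasDerivAt t (hline t)
    have h3 : HasDerivAt (fun t : ℝ => c / 2 * t ^ 2) (c / 2 * (2 * t)) t := by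
      simpa using (hasDerivAt_pow 2 t).const_mul (c / 2)
    exact (h2.add h3).congr_deriv (by ring)
  have hd2 : ∀ t ∈ Set.Icc (-1 : ℝ) 1,
      HasDerivAt (fun t : ℝ => fderiv ℝ F (q + t • w) w + c * t)
        (iteratedFDeriv ℝ 2 F (q + t • w) ![w, w] + c) t := fun t ht => by
    have h0 : ContDiffOn ℝ 1 (fderiv ℝ F) s := hF.fderiv_of_isOpen hs (by norm_num)
    have h1 : DifferentiableAt ℝ (fderiv ℝ F) (q + t • w) :=
      (h0.differentiableOn (by norm_num)).differentiableAt (hs.mem_nhds (hseg t ht))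
    have h2 : HasDerivAt (fun t : ℝ => fderiv ℝ F (q + t • w))
        (fderiv ℝ (fderiv ℝ F) (q + t • w) w) t :=
      h1.hasFDerivAt.comp_hasDerivAt t (hline t)
    have h3 : HasDerivAt (fun t : ℝ => fderiv ℝ F (q + t • w) w)
        (fderiv ℝ (fderiv ℝ F) (q + t • w) w w) t := by
      simpa using h2.clm_apply (hasDerivAt_const t w)
    have h4 : HasDerivAt (fun t : ℝ => c * t) c t := by
      simpa using (hasDerivAt_id t).const_mul c
    refine (h3.add h4).congr_deriv ?_
    rw [iteratedFDeriv_two_apply]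
    rfl
  -- The quadratic term offsets the lower bound `-c`. It vanishes at `t = 0` and equals `c / 2` at
  -- `t = ±1`, which is the error in the conclusion.
  have hconv : ConvexOn ℝ (Set.Icc (-1 : ℝ) 1)
      (fun t : ℝ => F (q + t • w) + c / 2 * t ^ 2) := by
    refine convexOn_of_hasDerivWithinAt2_nonneg (convex_Icc _ _)
      (fun t ht => (hd1 t ht).continuousAt.continuousWithinAt)
      (fun t ht => (hd1 t (interior_subset ht)).hasDerivWithinAt)
      (fun t ht => (hd2 t (interior_subset ht)).hasDerivWithinAt)
      (fun t ht => by linarith [hc t (interior_subset ht)])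
  have h1 : (1 : ℝ) ∈ Set.Icc (-1 : ℝ) 1 := by simp
  have h2 : (-1 : ℝ) ∈ Set.Icc (-1 : ℝ) 1 := by simp
  have := hconv.2 h1 h2 (show (0 : ℝ) ≤ 1 / 2 by norm_num) (show (0 : ℝ) ≤ 1 / 2 by norm_num)
    (by norm_num)
  norm_num [← sub_eq_add_neg] at this
  linarith

theorem eq_sum_single {n : ℕ} (w : Model n) :
    w = ∑ i, w i • (EuclideanSpace.single i (1 : ℝ) : Model n) := by
  simpa using ((EuclideanSpace.basisFun (Fin n) ℝ).sum_repr w).symm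

/-- The matrix of a bilinear form in the standard basis computes the form. -/
theorem dotProduct_mulVec_single {n : ℕ} (B : Model n →L[ℝ] Model n →L[ℝ] ℝ) (w : Model n) :
    (fun i => w i) ⬝ᵥ (Matrix.of fun i j => B (EuclideanSpace.single i (1 : ℝ))
      (EuclideanSpace.single j (1 : ℝ)) : Matrix (Fin n) (Fin n) ℝ).mulVec (fun i => w i)
      = B w w := by
  conv_rhs => rw [eq_sum_single w]
  simp only [map_sum, map_smul, sum_apply, smul_apply,
    dotProduct, Matrix.mulVec, Matrix.of_apply, smul_eq_mul, Finset.mul_sum]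
  rw [Finset.sum_comm]
  exact Finset.sum_congr rfl fun i _ => Finset.sum_congr rfl fun j _ => by ring

theorem dotProduct_hessMatrix_mulVec {n : ℕ} {M : Type*} [TopologicalSpace M]
    (e : OpenPartialHomeomorph M (Model n)) (u : M → ℝ)
    (y w : Model n) :
    (fun i => w i) ⬝ᵥ (hessMatrix e u y).mulVec (fun i => w i)
      = iteratedFDeriv ℝ 2 (u ∘ e.symm) y ![w, w] := by
  simpa [hessMatrix, iteratedFDeriv_two_apply] using
    dotProduct_mulVec_single (fderiv ℝ (fderiv ℝ (u ∘ e.symm)) y) w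

/-! ### From local to global Harnack inequalities -/

/-- On a compact connected space, a family of nonnegative functions satisfying a local Harnack
inequality satisfies a global one. -/
theorem exists_forall_le_mul_add_of_local {X : Type*} [TopologicalSpace X] [CompactSpace X]
    [ConnectedSpace X] (H : Set (X → ℝ))
    (hnonneg : ∀ h ∈ H, ∀ x, 0 ≤ h x)
    (hloc : ∀ p : X, ∃ U ∈ 𝓝 p, ∃ A B : ℝ, 0 ≤ A ∧ 0 ≤ B ∧
      ∀ h ∈ H, ∀ x ∈ U, ∀ y ∈ U, h x ≤ A * h y + B) :
    ∃ A B : ℝ, 0 ≤ A ∧ 0 ≤ B ∧ ∀ h ∈ H, ∀ x y, h x ≤ A * h y + B := by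
  -- Both directions are required so that `P` is symmetric; being also transitive and locally true,
  -- it holds everywhere by connectedness. The constants serve all of `H` at once.
  let P : X → X → Prop := fun x y => ∃ A B : ℝ, 0 ≤ A ∧ 0 ≤ B ∧
    ∀ h ∈ H, h x ≤ A * h y + B ∧ h y ≤ A * h x + B
  have htrans : ∀ x y z, P x y → P y z → P x z := by
    rintro x y z ⟨A, B, hA, hB, h1⟩ ⟨A', B', hA', hB', h2⟩
    refine ⟨A * A', A * B' + B + (A' * B + B'), by positivity, by positivity, fun h hh => ?_⟩
    have h3 := h1 h hh
    have h4 := h2 h hh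
    have h5 := mul_le_mul_of_nonneg_left h4.1 hA
    have h6 := mul_le_mul_of_nonneg_left h3.2 hA'
    have h7 : 0 ≤ A * B' := by positivity
    have h8 : 0 ≤ A' * B := by positivity
    constructor <;> linarith [h3.1, h4.2]
  have hP : ∀ x y, P x y := by
    intro x y
    have hsymm : Std.Symm P := ⟨fun x y ⟨A, B, hA, hB, h1⟩ => ⟨A, B, hA, hB, fun h hh =>
      (h1 h hh).symm⟩⟩
    refine PreconnectedSpace.induction₂ P (fun p => ?_) ⟨htrans⟩ x y
    obtain ⟨U, hU, A, B, hA, hB, h1⟩ := hloc p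
    filter_upwards [hU] with q hq
    have hp := mem_of_mem_nhds hU
    exact ⟨A, B, hA, hB, fun h hh => ⟨h1 h hh p hp q hq, h1 h hh q hq p hp⟩⟩
  obtain ⟨x₀⟩ : Nonempty X := inferInstance
  -- The constants in `P x x₀` depend on `x`; compactness makes them uniform.
  have hunif : ∃ A B : ℝ, 0 ≤ A ∧ 0 ≤ B ∧ ∀ h ∈ H, ∀ x ∈ (Set.univ : Set X),
      h x ≤ A * h x₀ + B ∧ h x₀ ≤ A * h x + B := by
    refine isCompact_univ.induction_on (p := fun s => ∃ A B : ℝ, 0 ≤ A ∧ 0 ≤ B ∧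
      ∀ h ∈ H, ∀ x ∈ s, h x ≤ A * h x₀ + B ∧ h x₀ ≤ A * h x + B) ?_ ?_ ?_ ?_
    · exact ⟨0, 0, le_rfl, le_rfl, fun h _ x hx => absurd hx (Set.notMem_empty x)⟩
    · rintro s t hst ⟨A, B, hA, hB, h1⟩
      exact ⟨A, B, hA, hB, fun h hh x hx => h1 h hh x (hst hx)⟩
    · rintro s t ⟨A, B, hA, hB, h1⟩ ⟨A', B', hA', hB', h2⟩
      -- Sums can replace maxima because every `h` is nonnegative.
      refine ⟨A + A', B + B', by positivity, by positivity, fun h hh x hx => ?_⟩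
      have e1 := mul_nonneg hA (hnonneg h hh x)
      have e2 := mul_nonneg hA (hnonneg h hh x₀)
      have e3 := mul_nonneg hA' (hnonneg h hh x)
      have e4 := mul_nonneg hA' (hnonneg h hh x₀)
      rcases hx with hx | hx
      · have := h1 h hh x hx
        constructor <;> linarith [this.1, this.2]
      · have := h2 h hh x hx
        constructor <;> linarith [this.1, this.2]
    · intro p _
      obtain ⟨U, hU, A, B, hA, hB, h1⟩ := hloc p
      obtain ⟨A', B', hA', hB', h2⟩ := hP p x₀
      have hp := mem_of_mem_nhds hU
      refine ⟨U, mem_nhdsWithin_of_mem_nhds hU, A * A', A * B' + B + (A' * B + B'),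
        by positivity, by positivity, fun h hh x hx => ?_⟩
      have e1 := mul_le_mul_of_nonneg_left (h2 h hh).1 hA
      have e2 := mul_le_mul_of_nonneg_left (h1 h hh p hp x hx) hA'
      have e3 := h1 h hh x hx p hp
      have h7 : 0 ≤ A * B' := by positivity
      have h8 : 0 ≤ A' * B := by positivity
      constructor <;> linarith [(h2 h hh).2]
  obtain ⟨A, B, hA, hB, h1⟩ := hunif
  refine ⟨A * A, A * B + B, by positivity, by positivity, fun h hh x y => ?_⟩
  have e1 := mul_le_mul_of_nonneg_left (h1 h hh y trivial).2 hA
  linarith [(h1 h hh x trivial).1]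

/-! ### Algebra and measurability for changes of chart -/

/-- The Gram matrix of a pulled back bilinear form. -/
theorem gram_comp {n : ℕ} (B : Model n →L[ℝ] Model n →L[ℝ] ℝ) (J : Model n →L[ℝ] Model n) :
    (Matrix.of fun i j => B (J (EuclideanSpace.single i 1)) (J (EuclideanSpace.single j 1)) :
        Matrix (Fin n) (Fin n) ℝ) =
      (LinearMap.toMatrix (EuclideanSpace.basisFun (Fin n) ℝ).toBasis
        (EuclideanSpace.basisFun (Fin n) ℝ).toBasis (J : Model n →ₗ[ℝ] Model n)).transpose *
      (Matrix.of fun i j => B (EuclideanSpace.single i 1) (EuclideanSpace.single j 1)) *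
      LinearMap.toMatrix (EuclideanSpace.basisFun (Fin n) ℝ).toBasis
        (EuclideanSpace.basisFun (Fin n) ℝ).toBasis (J : Model n →ₗ[ℝ] Model n) := by
  ext i j
  rw [Matrix.of_apply, eq_sum_single (J (EuclideanSpace.single i 1)),
    eq_sum_single (J (EuclideanSpace.single j 1))]
  simp only [map_sum, map_smul, sum_apply, smul_apply, Matrix.mul_apply, Matrix.of_apply,
    Matrix.transpose_apply, LinearMap.toMatrix_apply, OrthonormalBasis.coe_toBasis,
    OrthonormalBasis.coe_toBasis_repr_apply, EuclideanSpace.basisFun_apply,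
    EuclideanSpace.basisFun_repr, ContinuousLinearMap.coe_coe, smul_eq_mul, Finset.sum_mul,
    Finset.mul_sum]
  exact Finset.sum_congr rfl fun k _ => Finset.sum_congr rfl fun l _ => by ring

theorem measurableSet_target_inter_preimage_symm {n : ℕ} {M : Type*} [TopologicalSpace M]
    [MeasurableSpace M] [BorelSpace M] (e : OpenPartialHomeomorph M (Model n)) {A : Set M}
    (hA : MeasurableSet A) : MeasurableSet (e.target ∩ e.symm ⁻¹' A) := by
  have h : Measurable (e.target.domRestrict e.symm) :=
    (continuousOn_iff_continuous_domRestrict.1 e.continuousOn_symm).measurable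
  have h2 := e.open_target.measurableSet.subtype_image (h hA)
  convert! h2 using 1
  ext y
  simp [Set.domRestrict, and_comm]

variable {n : ℕ} {M : Type*} [TopologicalSpace M] [ChartedSpace (Model n) M]
  [IsManifold (𝓡 n) ∞ M]

/-! ### The metric in a chart -/

/-- The metric `g` read in the chart `e`, as a bilinear form on `ℝⁿ`. -/
noncomputable def chartForm (g : SmoothMetric n M) (e : OpenPartialHomeomorph M (Model n))
    (y : Model n) : Model n →L[ℝ] Model n →L[ℝ] ℝ :=
  ContinuousLinearMap.bilinearComp (E := Model n) (F := Model n) (g.inner (e.symm y))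
    (mfderiv (𝓡 n) (𝓡 n) e.symm y) (mfderiv (𝓡 n) (𝓡 n) e.symm y)

theorem chartForm_apply (g : SmoothMetric n M) (e : OpenPartialHomeomorph M (Model n))
    (y v w : Model n) : chartForm g e y v w = g.inner (e.symm y)
      (mfderiv (𝓡 n) (𝓡 n) e.symm y v) (mfderiv (𝓡 n) (𝓡 n) e.symm y w) := rfl

theorem metricMatrix_apply (g : SmoothMetric n M) (e : OpenPartialHomeomorph M (Model n))
    (y : Model n) (i j : Fin n) : metricMatrix g e y i j =
      chartForm g e y (EuclideanSpace.single i 1) (EuclideanSpace.single j 1) := rfl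

theorem dotProduct_metricMatrix_mulVec (g : SmoothMetric n M)
    (e : OpenPartialHomeomorph M (Model n)) (y w : Model n) :
    (fun i => w i) ⬝ᵥ (metricMatrix g e y).mulVec (fun i => w i) = chartForm g e y w w :=
  dotProduct_mulVec_single (chartForm g e y) w

theorem contMDiffOn_symm_of_mem_atlas {e : OpenPartialHomeomorph M (Model n)}
    (he : e ∈ atlas (Model n) M) : ContMDiffOn (𝓡 n) (𝓡 n) ∞ e.symm e.target :=
  contMDiffOn_symm_of_mem_maximalAtlas (IsManifold.subset_maximalAtlas he)

theorem contMDiffOn_of_mem_atlas {e : OpenPartialHomeomorph M (Model n)}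
    (he : e ∈ atlas (Model n) M) : ContMDiffOn (𝓡 n) (𝓡 n) ∞ e e.source :=
  contMDiffOn_of_mem_maximalAtlas (IsManifold.subset_maximalAtlas he)

theorem injective_mfderiv_symm {e : OpenPartialHomeomorph M (Model n)}
    (he : e ∈ atlas (Model n) M) {y : Model n} (hy : y ∈ e.target) :
    Function.Injective (mfderiv (𝓡 n) (𝓡 n) e.symm y) := by
  have h1 : MDifferentiableAt (𝓡 n) (𝓡 n) e.symm y :=
    ((contMDiffOn_symm_of_mem_atlas he).contMDiffAt (e.open_target.mem_nhds hy)).mdifferentiableAt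
      (by simp)
  have h2 : MDifferentiableAt (𝓡 n) (𝓡 n) e (e.symm y) :=
    ((contMDiffOn_of_mem_atlas he).contMDiffAt
      (e.open_source.mem_nhds (e.map_target hy))).mdifferentiableAt (by simp)
  have h3 := mfderiv_comp y h2 h1
  have h4 : mfderiv (𝓡 n) (𝓡 n) (e ∘ e.symm) y = ContinuousLinearMap.id ℝ _ := by
    rw [← mfderiv_id]
    refine Filter.EventuallyEq.mfderiv_eq ?_
    filter_upwards [e.open_target.mem_nhds hy] with z hz using e.right_inv hz
  intro v w hvw
  have h5 : ∀ v, mfderiv (𝓡 n) (𝓡 n) e (e.symm y) (mfderiv (𝓡 n) (𝓡 n) e.symm y v) = v := by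
    intro v
    have := congrArg (fun L : Model n →L[ℝ] Model n => L v) (h3.symm.trans h4)
    exact this
  rw [← h5 v, hvw, h5 w]

theorem posDef_metricMatrix (g : SmoothMetric n M) {e : OpenPartialHomeomorph M (Model n)}
    (he : e ∈ atlas (Model n) M) {y : Model n} (hy : y ∈ e.target) :
    (metricMatrix g e y).PosDef := by
  refine Matrix.PosDef.of_dotProduct_mulVec_pos ?_ fun {x} hx => ?_
  · ext i j
    exact g.symm _ _ _
  · have := dotProduct_metricMatrix_mulVec g e y (WithLp.toLp 2 x)
    simp only [star_trivial]
    refine lt_of_lt_of_eq ?_ this.symm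
    refine g.pos _ _ fun h0 => hx ?_
    have := injective_mfderiv_symm he hy (h0.trans (map_zero _).symm)
    exact congrArg (WithLp.ofLp) this

theorem continuousOn_metricMatrix (g : SmoothMetric n M) {e : OpenPartialHomeomorph M (Model n)}
    (he : e ∈ atlas (Model n) M) : ContinuousOn (metricMatrix g e) e.target := by
  have hs := contMDiffOn_symm_of_mem_atlas he
  -- Coordinate fields are smooth along `e.symm`: each is its tangent map applied to a constant
  -- field.
  have hv : ∀ v : Model n, ContMDiffOn (𝓡 n) ((𝓡 n).prod (𝓡 n)) ∞
      (fun y => Bundle.TotalSpace.mk' (Model n) (E := (TangentSpace (𝓡 n) : M → Type)) (e.symm y)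
        (mfderiv (𝓡 n) (𝓡 n) e.symm y v)) e.target := by
    intro v
    have h1 := hs.contMDiffOn_tangentMapWithin (m := ∞) (by simp) e.open_target.uniqueMDiffOn
    have h2 : ContMDiff (𝓡 n) ((𝓡 n).prod (𝓡 n)) ∞
        (fun y : Model n => (⟨y, v⟩ : TangentBundle (𝓡 n) (Model n))) :=
      contMDiff_vectorSpace_iff_contDiff.2 contDiff_const
    refine (h1.comp h2.contMDiffOn (fun y hy => hy)).congr fun y hy => ?_
    simp [tangentMapWithin, mfderivWithin_of_isOpen e.open_target hy, Bundle.TotalSpace.mk']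
  refine continuousOn_pi.2 fun i => continuousOn_pi.2 fun j => ?_
  have h := ContMDiffOn.clm_bundle_apply₂ (F₁ := Model n) (F₂ := Model n) (F₃ := ℝ)
    (E₁ := (TangentSpace (𝓡 n) : M → Type)) (E₂ := (TangentSpace (𝓡 n) : M → Type))
    (E₃ := Bundle.Trivial M ℝ)
    (g.contMDiff.comp_contMDiffOn hs)
    (hv (EuclideanSpace.single i 1)) (hv (EuclideanSpace.single j 1))
  intro y hy
  have hy' := h y hy
  simp only [Bundle.contMDiffWithinAt_totalSpace] at hy'
  exact hy'.2.continuousWithinAt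

/-! ### Admissible functions and their oscillation -/

/-- The smooth functions `u` for which `g + ∇du` is positive definite. -/
structure IsAdmissible (g : SmoothMetric n M) (u : M → ℝ) : Prop where
  smooth : ContMDiff (𝓡 n) 𝓘(ℝ, ℝ) ∞ u
  posDef : ∀ e ∈ atlas (Model n) M, ∀ y ∈ e.target,
    (metricMatrix g e y + hessMatrix e u y).PosDef

theorem IsFlowSolution.isAdmissible {g : SmoothMetric n M} {f : M → ℝ} {φ : ℝ → M → ℝ}
    (hφ : IsFlowSolution g f φ) {t : ℝ} (ht : 0 ≤ t) : IsAdmissible g (φ t) where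
  smooth := by
    have h : ContMDiff (𝓡 n) (𝓘(ℝ, ℝ).prod (𝓡 n)) ∞ (fun x : M => (t, x)) :=
      contMDiff_const.prodMk contMDiff_id
    exact contMDiffOn_univ.1 (hφ.smooth.comp h.contMDiffOn fun x _ => ⟨ht, trivial⟩)
  posDef := hφ.posDef t ht

theorem IsAdmissible.neg_chartForm_le {g : SmoothMetric n M} {u : M → ℝ} (hu : IsAdmissible g u)
    {e : OpenPartialHomeomorph M (Model n)} (he : e ∈ atlas (Model n) M) {y : Model n}
    (hy : y ∈ e.target) (w : Model n) :
    -chartForm g e y w w ≤ iteratedFDeriv ℝ 2 (u ∘ e.symm) y ![w, w] := by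
  have h := (hu.posDef e he y hy).posSemidef.dotProduct_mulVec_nonneg (fun i => w i)
  rw [star_trivial, Matrix.add_mulVec, dotProduct_add, dotProduct_metricMatrix_mulVec,
    dotProduct_hessMatrix_mulVec] at h
  linarith

/-- Near a point the metric is bounded by a multiple of the Euclidean metric of a chart. -/
theorem exists_eventually_chartForm_le (g : SmoothMetric n M)
    {e : OpenPartialHomeomorph M (Model n)} (he : e ∈ atlas (Model n) M) {y₀ : Model n}
    (hy₀ : y₀ ∈ e.target) :
    ∃ K : ℝ, 0 ≤ K ∧ ∀ᶠ y in 𝓝 y₀, ∀ w, chartForm g e y w w ≤ K * ‖w‖ ^ 2 := by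
  have hc := (continuousOn_metricMatrix g he).continuousAt (e.open_target.mem_nhds hy₀)
  have hev : ∀ᶠ y in 𝓝 y₀, ∀ i j,
      |metricMatrix g e y i j| < |metricMatrix g e y₀ i j| + 1 := by
    refine Filter.eventually_all.2 fun i => Filter.eventually_all.2 fun j => ?_
    have : ContinuousAt (fun y => |metricMatrix g e y i j|) y₀ :=
      ((continuous_apply_apply i j).continuousAt.comp hc).abs
    exact this.eventually_lt_const (by linarith)
  refine ⟨∑ i, ∑ j, (|metricMatrix g e y₀ i j| + 1), by positivity, ?_⟩
  filter_upwards [hev] with y hy w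
  rw [← dotProduct_metricMatrix_mulVec]
  simp only [dotProduct, Matrix.mulVec, Finset.mul_sum, Finset.sum_mul]
  refine Finset.sum_le_sum fun i _ => Finset.sum_le_sum fun j _ => ?_
  have hi : |w i| ≤ ‖w‖ := by simpa using PiLp.norm_apply_le w i
  have hj : |w j| ≤ ‖w‖ := by simpa using PiLp.norm_apply_le w j
  calc w i * (metricMatrix g e y i j * w j)
      ≤ |w i * (metricMatrix g e y i j * w j)| := le_abs_self _
    _ = |metricMatrix g e y i j| * (|w i| * |w j|) := by rw [abs_mul, abs_mul]; ring
    _ ≤ (|metricMatrix g e y₀ i j| + 1) * (‖w‖ * ‖w‖) :=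
        mul_le_mul (hy i j).le (mul_le_mul hi hj (abs_nonneg _) (norm_nonneg _))
          (by positivity) (by positivity)
    _ = _ := by ring

/-- Local Harnack inequality for `S - u`, where `u` is admissible and `u ≤ S`. -/
theorem exists_nhds_forall_sub_le (g : SmoothMetric n M) (p : M) :
    ∃ U ∈ 𝓝 p, ∃ B : ℝ, 0 ≤ B ∧ ∀ u, IsAdmissible g u → ∀ S : ℝ, (∀ x, u x ≤ S) →
      ∀ x ∈ U, ∀ q ∈ U, S - u x ≤ 2 * (S - u q) + B := by
  set e := chartAt (Model n) p with he_def
  have he : e ∈ atlas (Model n) M := chart_mem_atlas _ p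
  have hp : p ∈ e.source := mem_chart_source _ p
  obtain ⟨K, hK, hev⟩ := exists_eventually_chartForm_le g he (e.map_source hp)
  obtain ⟨R, hR, hball⟩ := Metric.eventually_nhds_iff_ball.1
    (hev.and (e.open_target.mem_nhds (e.map_source hp)))
  -- With `x` and `q` within `R / 3` of the centre, the segment from `x` to its reflection through
  -- `q` stays within `R / 3 + 2 * R / 3 = R`.
  refine ⟨e.source ∩ e ⁻¹' Metric.ball (e p) (R / 3),
    e.isOpen_inter_preimage Metric.isOpen_ball |>.mem_nhds
      ⟨hp, Metric.mem_ball_self (by positivity)⟩, K * R ^ 2, by positivity, ?_⟩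
  rintro u hu S hS x ⟨hx, hx'⟩ q ⟨hq, hq'⟩
  have hF : ContDiffOn ℝ 2 (u ∘ e.symm) e.target :=
    (contMDiffOn_iff_contDiffOn.1 (hu.smooth.comp_contMDiffOn
      (contMDiffOn_symm_of_mem_atlas he))).of_le (WithTop.coe_le_coe.2 le_top)
  have hw : ‖e x - e q‖ ≤ 2 * R / 3 := by
    rw [← dist_eq_norm]
    have := dist_triangle_right (e x) (e q) (e p)
    rw [Set.mem_preimage, Metric.mem_ball] at hx' hq'
    linarith
  have hseg : ∀ t ∈ Set.Icc (-1 : ℝ) 1, e q + t • (e x - e q) ∈ Metric.ball (e p) R := by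
    intro t ht
    rw [Metric.mem_ball, dist_eq_norm]
    have h1 : ‖t • (e x - e q)‖ ≤ ‖e x - e q‖ := by
      rw [norm_smul]
      exact mul_le_of_le_one_left (norm_nonneg _) (abs_le.2 ht)
    have h2 : ‖e q - e p‖ < R / 3 := by rwa [← dist_eq_norm]
    calc ‖e q + t • (e x - e q) - e p‖ = ‖(e q - e p) + t • (e x - e q)‖ := by congr 1; abel
      _ ≤ ‖e q - e p‖ + ‖t • (e x - e q)‖ := norm_add_le _ _
      _ < R := by linarith
  have key := le_midpoint_add_of_neg_le_iteratedFDeriv_two e.open_target hF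
    (q := e q) (w := e x - e q) (c := K * R ^ 2) (fun t ht => (hball _ (hseg t ht)).2)
    (fun t ht => by
      have h1 := hu.neg_chartForm_le he (hball _ (hseg t ht)).2 (e x - e q)
      have h2 := (hball _ (hseg t ht)).1 (e x - e q)
      have h3 : K * ‖e x - e q‖ ^ 2 ≤ K * R ^ 2 := by
        gcongr
        linarith
      linarith)
  simp only [Function.comp_apply, add_sub_cancel, e.left_inv hx, e.left_inv hq] at key
  -- At the reflected point only the upper bound `S` is used.
  linarith [hS (e.symm (e q - (e x - e q)))]

/-- The oscillation of admissible functions is bounded by a constant depending on `g` only. -/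
theorem exists_forall_sub_le_of_isAdmissible [CompactSpace M] [ConnectedSpace M]
    (g : SmoothMetric n M) :
    ∃ C : ℝ, 0 ≤ C ∧ ∀ u, IsAdmissible g u → ∀ x y, u x - u y ≤ C := by
  obtain ⟨A, B, -, hB, h⟩ := exists_forall_le_mul_add_of_local
    {h : M → ℝ | ∃ u S, IsAdmissible g u ∧ (∀ x, u x ≤ S) ∧ h = fun x => S - u x}
    (by rintro h ⟨u, S, -, hS, rfl⟩ x; linarith [hS x])
    (fun p => by
      obtain ⟨U, hU, B, hB, h⟩ := exists_nhds_forall_sub_le g p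
      refine ⟨U, hU, 2, B, by norm_num, hB, ?_⟩
      rintro _ ⟨u, S, hu, hS, rfl⟩ x hx q hq
      exact h u hu S hS x hx q hq)
  refine ⟨B, hB, fun u hu x y => ?_⟩
  obtain ⟨z, -, hz⟩ := isCompact_univ.exists_isMaxOn Set.univ_nonempty
    hu.smooth.continuous.continuousOn
  have hz' : ∀ x, u x ≤ u z := fun x => hz trivial
  -- `S - u` vanishes at the maximum point `z`, so only `B` survives.
  have := h _ ⟨u, u z, hu, hz', rfl⟩ y z
  simp only [sub_self, mul_zero, zero_add] at this
  linarith [hz' x]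

/-! ### Changes of chart and the Riemannian volume -/

theorem differentiableAt_transition {e e' : OpenPartialHomeomorph M (Model n)}
    (he : e ∈ atlas (Model n) M) (he' : e' ∈ atlas (Model n) M) {y : Model n}
    (hy : y ∈ e.target) (hy' : e.symm y ∈ e'.source) :
    DifferentiableAt ℝ (e' ∘ e.symm) y := by
  have h1 : MDifferentiableAt (𝓡 n) (𝓡 n) e.symm y :=
    ((contMDiffOn_symm_of_mem_atlas he).contMDiffAt (e.open_target.mem_nhds hy)).mdifferentiableAt
      (by simp)
  have h2 : MDifferentiableAt (𝓡 n) (𝓡 n) e' (e.symm y) :=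
    ((contMDiffOn_of_mem_atlas he').contMDiffAt
      (e'.open_source.mem_nhds hy')).mdifferentiableAt (by simp)
  exact (h2.comp y h1).differentiableAt

/-- Transports the inner product between base points that are equal but not definitionally so, such
as `e'.symm (e' (e.symm y))` and `e.symm y`. -/
theorem inner_congr (g : SmoothMetric n M) {p q : M} (h : p = q) (v w : Model n) :
    g.inner p v w = g.inner q v w := by
  subst h; rfl

theorem chartForm_transition (g : SmoothMetric n M) {e e' : OpenPartialHomeomorph M (Model n)}
    (he : e ∈ atlas (Model n) M) (he' : e' ∈ atlas (Model n) M) {y : Model n}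
    (hy : y ∈ e.target) (hy' : e.symm y ∈ e'.source) (v w : Model n) :
    chartForm g e y v w = chartForm g e' (e' (e.symm y))
      (fderiv ℝ (e' ∘ e.symm) y v) (fderiv ℝ (e' ∘ e.symm) y w) := by
  have h1 : MDifferentiableAt (𝓡 n) (𝓡 n) e'.symm (e' (e.symm y)) :=
    ((contMDiffOn_symm_of_mem_atlas he').contMDiffAt
      (e'.open_target.mem_nhds (e'.map_source hy'))).mdifferentiableAt (by simp)
  have h2 : MDifferentiableAt (𝓡 n) (𝓡 n) (e' ∘ e.symm) y :=
    (differentiableAt_transition he he' hy hy').mdifferentiableAt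
  have h3 : (e'.symm ∘ (e' ∘ e.symm)) =ᶠ[𝓝 y] e.symm := by
    have : ContinuousAt e.symm y := e.continuousAt_symm hy
    filter_upwards [this.eventually (e'.open_source.mem_nhds hy')] with z hz
    exact e'.left_inv hz
  have h4 : ∀ v : Model n, (mfderiv (𝓡 n) (𝓡 n) e.symm y v : Model n) =
      mfderiv (𝓡 n) (𝓡 n) e'.symm (e' (e.symm y)) (fderiv ℝ (e' ∘ e.symm) y v) := by
    intro v
    have h5 := h3.mfderiv_eq (I := 𝓡 n) (I' := 𝓡 n)
    have h6 := mfderiv_comp y h1 h2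
    rw [mfderiv_eq_fderiv] at h6
    exact congrArg (fun L : Model n →L[ℝ] Model n => L v) (h5.symm.trans h6)
  rw [chartForm_apply, chartForm_apply]
  refine (inner_congr g (e'.left_inv hy').symm _ _).trans ?_
  rw [h4 v, h4 w]

/-- The square root of this squared Jacobian is the factor in the change of variables formula. -/
theorem det_metricMatrix_transition (g : SmoothMetric n M)
    {e e' : OpenPartialHomeomorph M (Model n)}
    (he : e ∈ atlas (Model n) M) (he' : e' ∈ atlas (Model n) M) {y : Model n}
    (hy : y ∈ e.target) (hy' : e.symm y ∈ e'.source) :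
    (metricMatrix g e y).det =
      (fderiv ℝ (e' ∘ e.symm) y).det ^ 2 * (metricMatrix g e' (e' (e.symm y))).det := by
  have h : metricMatrix g e y = Matrix.of fun i j => chartForm g e' (e' (e.symm y))
      (fderiv ℝ (e' ∘ e.symm) y (EuclideanSpace.single i 1))
      (fderiv ℝ (e' ∘ e.symm) y (EuclideanSpace.single j 1)) := by
    ext i j
    exact chartForm_transition g he he' hy hy' _ _
  rw [h, gram_comp, Matrix.det_mul, Matrix.det_mul, Matrix.det_transpose, LinearMap.det_toMatrix,
    ContinuousLinearMap.det, pow_two]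
  change _ * (metricMatrix g e' (e' (e.symm y))).det * _ = _
  ring

variable [MeasurableSpace M] [BorelSpace M]

theorem chartVolume_apply (g : SmoothMetric n M) (e : OpenPartialHomeomorph M (Model n)) {A : Set M}
    (hA : MeasurableSet A) :
    chartVolume g e A = ∫⁻ y in e.target ∩ e.symm ⁻¹' A,
      ENNReal.ofReal (Real.sqrt (metricMatrix g e y).det) := by
  have h1 : AEMeasurable e.symm ((volume : Measure (Model n)).restrict e.target) :=
    e.continuousOn_symm.aemeasurable e.open_target.measurableSet
  rw [chartVolume, Measure.map_apply_of_aemeasurable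
    (h1.mono_ac (withDensity_absolutelyContinuous _ _)) hA, withDensity_apply',
    Measure.restrict_restrict' e.open_target.measurableSet, Set.inter_comm]

/-- The measures of two charts agree on the overlap of the charts. -/
theorem chartVolume_eq_of_subset (g : SmoothMetric n M) {e e' : OpenPartialHomeomorph M (Model n)}
    (he : e ∈ atlas (Model n) M) (he' : e' ∈ atlas (Model n) M) {A : Set M}
    (hA : MeasurableSet A) (hAe : A ⊆ e.source) (hAe' : A ⊆ e'.source) :
    chartVolume g e A = chartVolume g e' A := by
  have himage : (e' ∘ e.symm) '' (e.target ∩ e.symm ⁻¹' A) = e'.target ∩ e'.symm ⁻¹' A := by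
    ext z
    constructor
    · rintro ⟨y, ⟨hy, hyA⟩, rfl⟩
      refine ⟨e'.map_source (hAe' hyA), ?_⟩
      simpa [e'.left_inv (hAe' hyA)] using hyA
    · rintro ⟨hz, hzA⟩
      refine ⟨e (e'.symm z), ⟨e.map_source (hAe hzA), ?_⟩, ?_⟩
      · simpa [e.left_inv (hAe hzA)] using hzA
      · simp [e.left_inv (hAe hzA), e'.right_inv hz]
  have hinj : Set.InjOn (e' ∘ e.symm) (e.target ∩ e.symm ⁻¹' A) := by
    rintro y ⟨hy, hyA⟩ z ⟨hz, hzA⟩ hyz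
    exact e.symm.injOn hy hz (e'.injOn (hAe' hyA) (hAe' hzA) hyz)
  have hmeas := measurableSet_target_inter_preimage_symm e hA
  rw [chartVolume_apply g e hA, chartVolume_apply g e' hA, ← himage,
    lintegral_image_eq_lintegral_abs_det_fderiv_mul volume hmeas (fun y hy =>
      (differentiableAt_transition he he' hy.1 (hAe' hy.2)).hasFDerivAt.hasFDerivWithinAt) hinj]
  refine setLIntegral_congr_fun hmeas fun y hy => ?_
  simp only [Function.comp_apply]
  rw [det_metricMatrix_transition g he he' hy.1 (hAe' hy.2), Real.sqrt_mul (sq_nonneg _),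
    Real.sqrt_sq_eq_abs, ENNReal.ofReal_mul (abs_nonneg _)]

theorem chartVolume_inter_source (g : SmoothMetric n M) (e : OpenPartialHomeomorph M (Model n))
    {A : Set M} (hA : MeasurableSet A) : chartVolume g e (A ∩ e.source) = chartVolume g e A := by
  rw [chartVolume_apply g e hA, chartVolume_apply g e (hA.inter e.open_source.measurableSet)]
  congr 2
  ext y
  simp only [Set.mem_inter_iff, Set.mem_preimage]
  exact ⟨fun h => ⟨h.1, h.2.1⟩, fun h => ⟨h.1, h.2, e.map_target h.1⟩⟩

/-- A supremum of measures is bounded above by exhibiting a dominating measure: `chartVolume g e`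
plus infinite mass off `e.source`. Agreement on overlaps gives the domination, and the added mass
does not charge `A`. -/
theorem riemannianVolume_le_chartVolume (g : SmoothMetric n M)
    {e : OpenPartialHomeomorph M (Model n)} (he : e ∈ atlas (Model n) M) {A : Set M}
    (hA : MeasurableSet A) (hAe : A ⊆ e.source) :
    riemannianVolume g A ≤ chartVolume g e A := by
  have hs : MeasurableSet e.source := e.open_source.measurableSet
  have hle : riemannianVolume g ≤
      chartVolume g e + (⊤ : Measure M).restrict e.sourceᶜ := by
    refine iSup₂_le fun e' he' => Measure.le_iff.2 fun B hB => ?_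
    rw [← measure_inter_add_sdiff B hs, Measure.add_apply]
    refine add_le_add ?_ ?_
    · rw [← chartVolume_inter_source g e' (hB.inter hs), chartVolume_eq_of_subset g he' he
        ((hB.inter hs).inter e'.open_source.measurableSet) Set.inter_subset_right
        fun x hx => hx.1.2]
      exact measure_mono fun x hx => hx.1.1
    · rw [Measure.restrict_apply hB, ← Set.sdiff_eq]
      exact (le_top : chartVolume g e' ≤ ⊤) _
  refine (hle A).trans ?_
  rw [Measure.add_apply, Measure.restrict_apply hA, ← Set.sdiff_eq, Set.sdiff_eq_empty.2 hAe,
    measure_empty, add_zero]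

/-- The Riemannian volume of a compact manifold is finite. -/
theorem isFiniteMeasure_riemannianVolume [CompactSpace M] (g : SmoothMetric n M) :
    IsFiniteMeasure (riemannianVolume g) := by
  refine ⟨isCompact_univ.measure_lt_top_of_nhdsWithin fun p _ => ?_⟩
  set e := chartAt (Model n) p
  have he : e ∈ atlas (Model n) M := chart_mem_atlas _ p
  have hp : p ∈ e.source := mem_chart_source _ p
  have hc : ContinuousAt (fun y => Real.sqrt (metricMatrix g e y).det) (e p) :=
    (((continuous_id.matrix_det.comp_continuousOn (continuousOn_metricMatrix g he)).continuousAt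
      (e.open_target.mem_nhds (e.map_source hp)))).sqrt
  obtain ⟨R, hR, hball⟩ := Metric.eventually_nhds_iff_ball.1
    (hc.eventually_lt_const (lt_add_one _))
  have hopen : IsOpen (e.source ∩ e ⁻¹' Metric.ball (e p) R) :=
    e.isOpen_inter_preimage Metric.isOpen_ball
  refine ⟨e.source ∩ e ⁻¹' Metric.ball (e p) R,
    mem_nhdsWithin_of_mem_nhds (hopen.mem_nhds ⟨hp, Metric.mem_ball_self hR⟩), ?_⟩
  refine (riemannianVolume_le_chartVolume g he hopen.measurableSet
    Set.inter_subset_left).trans_lt ?_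
  rw [chartVolume_apply g e hopen.measurableSet]
  have hsub : e.target ∩ e.symm ⁻¹' (e.source ∩ e ⁻¹' Metric.ball (e p) R) ⊆
      Metric.ball (e p) R := by
    rintro y ⟨hy, -, hy'⟩
    simpa [e.right_inv hy] using hy'
  refine (lintegral_mono_set hsub).trans_lt ?_
  refine (setLIntegral_mono (g := fun _ => ENNReal.ofReal
    (Real.sqrt (metricMatrix g e (e p)).det + 1)) measurable_const fun y hy =>
      ENNReal.ofReal_le_ofReal (hball y hy).le).trans_lt ?_
  rw [setLIntegral_const]
  exact ENNReal.mul_lt_top ENNReal.ofReal_lt_top measure_ball_lt_top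

/-- The Riemannian volume of a nonempty manifold is nonzero. -/
theorem riemannianVolume_univ_ne_zero [Nonempty M] (g : SmoothMetric n M) :
    riemannianVolume g Set.univ ≠ 0 := by
  obtain ⟨p⟩ : Nonempty M := inferInstance
  set e := chartAt (Model n) p
  have he : e ∈ atlas (Model n) M := chart_mem_atlas _ p
  have hp : p ∈ e.source := mem_chart_source _ p
  have hle : chartVolume g e ≤ riemannianVolume g :=
    le_iSup₂ (f := fun e (_ : e ∈ atlas (Model n) M) => chartVolume g e) e he
  have hmeas : AEMeasurable (fun y => ENNReal.ofReal (Real.sqrt (metricMatrix g e y).det))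
      (volume.restrict e.target) :=
    (((continuous_id.matrix_det.comp_continuousOn
      (continuousOn_metricMatrix g he)).sqrt).aemeasurable e.open_target.measurableSet).ennreal_ofReal
  intro h0
  have h1 : chartVolume g e Set.univ = 0 := le_antisymm (h0 ▸ hle _) (zero_le)
  rw [chartVolume_apply g e MeasurableSet.univ, Set.preimage_univ, Set.inter_univ,
    lintegral_eq_zero_iff' hmeas, Filter.EventuallyEq,
    ae_restrict_iff' e.open_target.measurableSet] at h1
  -- The density is positive throughout `e.target`, so it can vanish almost everywhere there only if
  -- this nonempty open set is null.
  have h2 : volume e.target = 0 := by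
    refine measure_mono_null ?_ (ae_iff.1 h1)
    intro y hy hy'
    have := hy' hy
    simp only [Pi.zero_apply, ENNReal.ofReal_eq_zero] at this
    exact absurd (Real.sqrt_pos.2 (posDef_metricMatrix g he hy).det_pos) this.not_gt
  exact (e.open_target.measure_pos volume ⟨e p, e.map_source hp⟩).ne' h2

/-- Integrating `u x - C ≤ u y ≤ u x + C` in `y` puts the mean of `u` within `C` of `u x`. -/
theorem abs_normalization_le [CompactSpace M] [Nonempty M] (g : SmoothMetric n M) {u : M → ℝ}
    (hu : Continuous u) {C : ℝ} (hC : ∀ x y, u x - u y ≤ C) (x : M) :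
    |normalization g u x| ≤ C := by
  have := isFiniteMeasure_riemannianVolume g
  have hV : 0 < (riemannianVolume g).real Set.univ :=
    ENNReal.toReal_pos (riemannianVolume_univ_ne_zero g) (measure_ne_top _ _)
  have hint : Integrable u (riemannianVolume g) :=
    hu.integrable_of_hasCompactSupport (HasCompactSupport.of_compactSpace u)
  have h1 : ∫ y, u y ∂(riemannianVolume g) ≤ (riemannianVolume g).real Set.univ * (u x + C) := by
    rw [← smul_eq_mul, ← integral_const]
    exact integral_mono hint (integrable_const _) fun y => by linarith [hC y x]
  have h2 : (riemannianVolume g).real Set.univ * (u x - C) ≤ ∫ y, u y ∂(riemannianVolume g) := by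
    rw [← smul_eq_mul, ← integral_const]
    exact integral_mono (integrable_const _) hint fun y => by linarith [hC x y]
  change |u x - 1 / (riemannianVolume g).real Set.univ * _| ≤ C
  rw [one_div_mul_eq_div, abs_le]
  have h3 := (div_le_iff₀' hV).2 h1
  have h4 := (le_div_iff₀' hV).2 h2
  constructor <;> linarith

end HessianFlow

theorem proposition5p3 (n : ℕ) (M : Type*) [TopologicalSpace M] [T2Space M] [CompactSpace M]
    [ConnectedSpace M] [ChartedSpace (HessianFlow.Model n) M] [IsManifold (𝓡 n) ∞ M]
    [MeasurableSpace M] [BorelSpace M]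
    (hM : HessianFlow.IsAffineAtlas n M)
    (g₀ : HessianFlow.SmoothMetric n M) (hg₀ : HessianFlow.IsHessianMetric g₀)
    (f : M → ℝ) (hf : ContMDiff (𝓡 n) 𝓘(ℝ, ℝ) ∞ f) :
    ∃ C : ℝ, 0 < C ∧ ∀ φ : ℝ → M → ℝ, HessianFlow.IsFlowSolution g₀ f φ →
      ∀ t : ℝ, 0 ≤ t → ∀ x : M, |HessianFlow.normalization g₀ (φ t) x| ≤ C := by
  obtain ⟨C, hC, h⟩ := HessianFlow.exists_forall_sub_le_of_isAdmissible g₀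
  -- The oscillation bound `C` is only nonnegative; adding `1` makes the constant positive.
  refine ⟨C + 1, by linarith, fun φ hφ t ht x => ?_⟩
  have hadm := hφ.isAdmissible ht
  exact HessianFlow.abs_normalization_le g₀ hadm.smooth.continuous
    (fun x y => (h _ hadm x y).trans (by linarith)) x
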